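/- Let $\mathcal L_{PA}$ be the first-order language with equality of Peano arithmetic, with a function symbol for every (code of a) primitive recursive function, among them $0$ and $S$, and a predicate symbol $R_f$ for every such code $f$. In the standard model $\mathbb N$ the function symbols have their usual meaning and $R_f(\vec x)$ means $f(\vec x)=0$. Let $\mathcal L$ be $\mathcal L_{PA}$ together with one new unary predicate symbol $I$; we write $t\in I$ for $It$. Let $A(x,X)$ be a formula of $\mathcal L_{PA}$ extended by a unary second-order variable $X$, with no free first-order variable other than $x$ and no second-order quantifiers, in which $X$ occurs only positively. The theory $ID_1$ (for $A$) is the theory in classical first-order logic with equality, in the language $\mathcal L$, whose axioms are the universal closures of the following formulas: - $\neg\, Sx=0$ and $Sx=Sy\rightarrow x=y$; - the defining equations of all the primitive recursive function symbols, and $R_f(\vec x)\leftrightarrow f(\vec x)=0$ for the predicate symbols; - induction: $\psi(0)\wedge\forall x(\psi(x)\rightarrow\psi(Sx))\rightarrow\forall x\,\psi(x)$, for every formula $\psi$ of $\mathcal L$ (parameters allowed); - inductive definition: $\forall x(x\in I\leftrightarrow A(x,I))$; - inductive closure: $\forall x(A(x,\psi)\rightarrow\psi(x))\rightarrow\forall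 x(x\in I\rightarrow\psi(x))$, for every formula $\psi$ of $\mathcal L$ (parameters allowed), where $A(x,\psi)$ arises from $A(x,X)$ by replacing each atom $t\in X$ by $\psi(t)$. **Theorem ($1$-consistency of $ID_1$).** Let $\phi(x)$ be a quantifier-free formula with no free variable other than $x$ that does not contain the symbol $I$. If $ID_1\vdash\exists x\,\phi(x)$, then there is a natural number $n$ such that $\phi(n)$ holds, i.e. is true in the standard model $\mathbb N$. -/

import Mathlib

/-! ### First-order logic: substitution and derivability

Formulas with `n` free variables are `L.BoundedFormula Empty n`; the variable bound by the quantifier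
of `φ.all`, with `φ : L.BoundedFormula Empty (n + 1)`, is the last one, `Fin.last n`. -/

namespace FOL

open FirstOrder FirstOrder.Language

variable {L : FirstOrder.Language.{0, 0}}

/-- Terms with `n` variables. -/
abbrev Tm (L : FirstOrder.Language.{0, 0}) (n : ℕ) : Type := L.Term (Empty ⊕ Fin n)

/-- Formulas with `n` free variables. -/
abbrev Fm (L : FirstOrder.Language.{0, 0}) (n : ℕ) : Type := L.BoundedFormula Empty n

/-- The `i`-th variable. -/
def v {n : ℕ} (i : Fin n) : Tm L n := Term.var (Sum.inr i)

/-- A term with `n` variables, seen as a term with one more variable. -/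
def wkTm {n : ℕ} (t : Tm L n) : Tm L (n + 1) := t.relabel (Sum.map id Fin.castSucc)

/-- Simultaneous substitution of terms for the variables of a term. -/
def substTm {n m : ℕ} (t : Tm L n) (σ : Fin n → Tm L m) : Tm L m :=
  Term.subst t (Sum.elim (fun e => e.elim) σ)

/-- A substitution, extended by the identity on one new (last) variable. -/
def up {n m : ℕ} (σ : Fin n → Tm L m) : Fin (n + 1) → Tm L (m + 1) :=
  Fin.snoc (α := fun _ => Tm L (m + 1)) (fun i => wkTm (σ i)) (v (Fin.last m))

/-- Simultaneous capture-avoiding substitution of terms for the free variables of a formula. -/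
def subst : {n : ℕ} → Fm L n → {m : ℕ} → (Fin n → Tm L m) → Fm L m
  | _, .falsum, _, _ => .falsum
  | _, .equal s t, _, σ => .equal (substTm s σ) (substTm t σ)
  | _, .rel R ts, _, σ => .rel R (fun i => substTm (ts i) σ)
  | _, .imp φ ψ, _, σ => .imp (subst φ σ) (subst ψ σ)
  | _, .all φ, _, σ => .all (subst φ (up σ))

/-- A formula with `n` free variables, seen as a formula with one more free variable. -/
def wk {n : ℕ} (φ : Fm L n) : Fm L (n + 1) := subst φ (fun i => v i.castSucc)

/-- `φ(t)`: substitution of the term `t` for the last free variable of `φ`. -/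
def inst {n : ℕ} (φ : Fm L (n + 1)) (t : Tm L n) : Fm L n :=
  subst φ (Fin.snoc (α := fun _ => Tm L n) v t)

/-- Natural deduction for classical first-order logic with equality; `Derives Γ φ` says that `φ`
has a derivation from the formulas in `Γ`, all with free variables among the first `n`. The
primitive connectives are `⊥`, `→`, `∀`; the others are Mathlib's abbreviations. -/
inductive Derives : {n : ℕ} → Set (Fm L n) → Fm L n → Prop
  | assumption {n : ℕ} {Γ : Set (Fm L n)} {φ : Fm L n} : φ ∈ Γ → Derives Γ φ
  | impI {n : ℕ} {Γ : Set (Fm L n)} {φ ψ : Fm L n} :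
      Derives (insert φ Γ) ψ → Derives Γ (φ.imp ψ)
  | impE {n : ℕ} {Γ : Set (Fm L n)} {φ ψ : Fm L n} :
      Derives Γ (φ.imp ψ) → Derives Γ φ → Derives Γ ψ
  | raa {n : ℕ} {Γ : Set (Fm L n)} {φ : Fm L n} :
      Derives (insert φ.not Γ) .falsum → Derives Γ φ
  | allI {n : ℕ} {Γ : Set (Fm L n)} {φ : Fm L (n + 1)} :
      Derives (wk '' Γ) φ → Derives Γ φ.all
  | allE {n : ℕ} {Γ : Set (Fm L n)} {φ : Fm L (n + 1)} (t : Tm L n) :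
      Derives Γ φ.all → Derives Γ (inst φ t)
  | eqRefl {n : ℕ} {Γ : Set (Fm L n)} (t : Tm L n) : Derives Γ (.equal t t)
  | eqSubst {n : ℕ} {Γ : Set (Fm L n)} {s t : Tm L n} (φ : Fm L (n + 1)) :
      Derives Γ (.equal s t) → Derives Γ (inst φ s) → Derives Γ (inst φ t)

/-- `T ⊢ σ` for a theory `T` and a sentence `σ`. -/
def Provable (T : L.Theory) (σ : L.Sentence) : Prop := Derives (n := 0) T σ

end FOL

/-! ### The languages of arithmetic and of `ID₁` -/

namespace ID1

open FirstOrder FirstOrder.Language FOL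

/-- Codes for the primitive recursive functions of each arity. -/
inductive PR : ℕ → Type
  | zero : PR 0
  | succ : PR 1
  | proj {n : ℕ} (i : Fin n) : PR n
  | comp {n m : ℕ} (f : PR m) (g : Fin m → PR n) : PR n
  | prec {n : ℕ} (f : PR n) (g : PR (n + 2)) : PR (n + 1)

/-- The primitive recursive function with a given code. -/
def PR.eval : {n : ℕ} → PR n → (Fin n → ℕ) → ℕ
  | _, .zero, _ => 0
  | _, .succ, x => x 0 + 1
  | _, .proj i, x => x i
  | _, .comp f g, x => f.eval (fun i => (g i).eval x)
  | _, .prec f g, x =>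
      Nat.rec (f.eval (Fin.tail x))
        (fun y z => g.eval (Fin.cons y (Fin.cons z (Fin.tail x) : Fin _ → ℕ))) (x 0)

/-- The language of Peano arithmetic: a function symbol for every primitive recursive function
and a predicate symbol `R_f` for (the zero set of) every primitive recursive function `f`. -/
def arith : FirstOrder.Language.{0, 0} where
  Functions := PR
  Relations := PR

/-- The standard model. -/
instance : arith.Structure ℕ where
  funMap := fun (f : PR _) x => f.eval x
  RelMap := fun (f : PR _) x => f.eval x = 0

/-- Predicate symbols of `ID₁`: those of arithmetic and the unary `I`. -/
inductive Rel : ℕ → Type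
  | arith {n : ℕ} (f : PR n) : Rel n
  | I : Rel 1

/-- The language of `ID₁`. -/
def lang : FirstOrder.Language.{0, 0} where
  Functions := PR
  Relations := Rel

/-- The inclusion of the language of arithmetic into the language of `ID₁`. -/
def incl : arith →ᴸ lang where
  onFunction := fun _ f => f
  onRelation := fun _ f => Rel.arith f

/-- The term `f(ts)`. -/
def app {n k : ℕ} (f : PR k) (ts : Fin k → Tm lang n) : Tm lang n :=
  Term.func (L := lang) f ts

/-- The term `0`. -/
def zeroT {n : ℕ} : Tm lang n := app PR.zero ![]

/-- The term `S t`. -/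
def succT {n : ℕ} (t : Tm lang n) : Tm lang n := app PR.succ ![t]

/-- The formula `t ∈ I`. -/
def mem {n : ℕ} (t : Tm lang n) : Fm lang n := .rel (L := lang) Rel.I ![t]

/-- The formula `R_f(ts)`. -/
def relF {n k : ℕ} (f : PR k) (ts : Fin k → Tm lang n) : Fm lang n :=
  .rel (L := lang) (Rel.arith f) ts

/-- `Occurs true φ`: the predicate `I` occurs only positively in `φ`;
`Occurs false φ`: it occurs only negatively. -/
def Occurs : {n : ℕ} → Bool → Fm lang n → Prop
  | _, _, .falsum => True
  | _, _, .equal _ _ => True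
  | _, _, .rel (Rel.arith _) _ => True
  | _, b, .rel Rel.I _ => b = true
  | _, b, .imp φ ψ => Occurs (!b) φ ∧ Occurs b ψ
  | _, b, .all φ => Occurs b φ

/-- Replacement of each atom `t ∈ I` in a formula with `k` free variables by `φ(t)`. The last
variable of `φ` is the one for which `t` is substituted, the `n` others are parameters, and `ρ`
says which variables they are in the result. -/
def replaceI {n : ℕ} (φ : Fm lang (n + 1)) :
    {k : ℕ} → (Fin n → Fin k) → Fm lang k → Fm lang k
  | _, _, .falsum => .falsum
  | _, _, .equal s t => .equal s t
  | _, _, .rel (Rel.arith f) ts => relF f ts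
  | k, ρ, .rel Rel.I ts =>
      subst φ (Fin.snoc (α := fun _ => Tm lang k) (fun i => v (ρ i)) (ts 0))
  | _, ρ, .imp χ ψ => .imp (replaceI φ ρ χ) (replaceI φ ρ ψ)
  | _, ρ, .all χ => .all (replaceI φ (fun i => (ρ i).castSucc) χ)

/-- `A(x, φ)` for `A` with the one free variable `x`, in which the second order variable `X` is
written as `I`, and for `φ` with `n` parameters; the free variables of the result are the
parameters and, as the last one, `x`. -/
def plug {n : ℕ} (A : Fm lang 1) (φ : Fm lang (n + 1)) : Fm lang (n + 1) :=
  replaceI φ Fin.castSucc (subst A (fun _ => v (Fin.last n)))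

/-- The axioms of `ID₁` for the operator form `A(x, X)`, whose second order variable `X` is
written as `I`, so that `A(x, I)` is `A` itself. Open axioms and schemes with parameters are
universally closed by `alls`. -/
inductive IsAxiom (A : Fm lang 1) : lang.Sentence → Prop
  | succ_ne_zero : IsAxiom A
      (BoundedFormula.equal (succT (v (0 : Fin 1))) zeroT).not.alls
  | succ_inj : IsAxiom A
      ((BoundedFormula.equal (succT (v (0 : Fin 2))) (succT (v 1))).imp
        (.equal (v 0) (v 1))).alls
  | proj {n : ℕ} (i : Fin n) : IsAxiom A
      (BoundedFormula.equal (app (PR.proj i) v) (v i)).alls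
  | comp {n m : ℕ} (f : PR m) (g : Fin m → PR n) : IsAxiom A
      (BoundedFormula.equal (app (PR.comp f g) v) (app f (fun i => app (g i) v))).alls
  | prec_zero {n : ℕ} (f : PR n) (g : PR (n + 2)) : IsAxiom A
      (BoundedFormula.equal
        (app (PR.prec f g) (Fin.cons (α := fun _ => Tm lang n) zeroT v)) (app f v)).alls
  | prec_succ {n : ℕ} (f : PR n) (g : PR (n + 2)) : IsAxiom A
      (BoundedFormula.equal
        (app (PR.prec f g) (Fin.cons (α := fun _ => Tm lang (n + 1)) (succT (v 0))
          (fun i => v i.succ)))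
        (app g (Fin.cons (α := fun _ => Tm lang (n + 1)) (v 0)
          (Fin.cons (α := fun _ => Tm lang (n + 1)) (app (PR.prec f g) v)
            (fun i => v i.succ))))).alls
  | pred {n : ℕ} (f : PR n) : IsAxiom A
      ((relF f v).iff (.equal (app f v) zeroT)).alls
  /-- Induction: `φ(0) ∧ ∀x (φ(x) → φ(Sx)) → ∀x φ(x)`. -/
  | induction {n : ℕ} (φ : Fm lang (n + 1)) : IsAxiom A
      ((inst φ zeroT ⊓
        (φ.imp (subst φ (Fin.snoc (α := fun _ => Tm lang (n + 1)) (fun i => v i.castSucc)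
          (succT (v (Fin.last n)))))).all).imp φ.all).alls
  /-- Inductive definition: `∀x (x ∈ I ↔ A(x, I))`. -/
  | inductiveDefinition : IsAxiom A ((mem (v 0)).iff A).all
  /-- Inductive closure: `∀x (A(x, φ) → φ(x)) → ∀x (x ∈ I → φ(x))`. -/
  | inductiveClosure {n : ℕ} (φ : Fm lang (n + 1)) : IsAxiom A
      (((plug A φ).imp φ).all.imp ((mem (v (Fin.last n))).imp φ).all).alls

/-- The theory `ID₁` for the operator form `A`. -/
def theory (A : Fm lang 1) : lang.Theory := {σ | IsAxiom A σ}

end ID1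

/-! Interpret `I` in the standard model as the least fixed point of the operator
`S ↦ {a | A(a, S)}`, which is monotone because `X` occurs only positively in `A`. The defining axiom
of `I` then says that this set is a fixed point, and inductive closure follows from its being the
least pre-fixed point, applied to the set defined by `ψ`. So the standard model, expanded in this
way, satisfies `ID₁`, and by soundness every arithmetical sentence provable in `ID₁` is true. -/

namespace FOL

open FirstOrder FirstOrder.Language

variable {L : FirstOrder.Language.{0, 0}} {M : Type*} [L.Structure M] {n m : ℕ} {e : Empty → M}

theorem realize_wkTm (t : Tm L n) (x : Fin (n + 1) → M) :
    (wkTm t).realize (Sum.elim e x) = t.realize (Sum.elim e (x ∘ Fin.castSucc)) := by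
  simp [wkTm, Sum.elim_comp_map]

theorem realize_substTm (t : Tm L n) (σ : Fin n → Tm L m) (x : Fin m → M) :
    (substTm t σ).realize (Sum.elim e x) =
      t.realize (Sum.elim e fun i => (σ i).realize (Sum.elim e x)) := by
  rw [substTm, Term.realize_subst]
  congr 1
  ext (a | i)
  · exact a.elim
  · rfl

theorem realize_snoc (σ : Fin n → Tm L m) (t : Tm L m) (y : Empty ⊕ Fin m → M) :
    (fun i => (Fin.snoc (α := fun _ => Tm L m) σ t i).realize y) =
      Fin.snoc (α := fun _ => M) (fun i => (σ i).realize y) (t.realize y) :=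
  Fin.comp_snoc (Term.realize y) σ t

theorem realize_up (σ : Fin n → Tm L m) (x : Fin m → M) (a : M) :
    (fun i => (up σ i).realize (Sum.elim e (Fin.snoc (α := fun _ => M) x a))) =
      Fin.snoc (α := fun _ => M) (fun i => (σ i).realize (Sum.elim e x)) a := by
  simp only [up, realize_snoc, realize_wkTm]
  simp [v, Function.comp_def]

theorem realize_subst (φ : Fm L n) (σ : Fin n → Tm L m) (x : Fin m → M) :
    (subst φ σ).Realize e x ↔ φ.Realize e fun i => (σ i).realize (Sum.elim e x) := by
  induction φ generalizing m with
  | falsum => rfl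
  | equal s t => simp only [subst, BoundedFormula.Realize, realize_substTm]
  | rel R ts => simp only [subst, BoundedFormula.Realize, realize_substTm]
  | imp φ ψ ihφ ihψ => simp only [subst, BoundedFormula.realize_imp, ihφ, ihψ]
  | all φ ih => simp only [subst, BoundedFormula.realize_all, ih, realize_up]

theorem realize_wk (φ : Fm L n) (x : Fin n → M) (a : M) :
    (wk φ).Realize e (Fin.snoc (α := fun _ => M) x a) ↔ φ.Realize e x := by
  simp [wk, realize_subst, v]

theorem realize_inst (φ : Fm L (n + 1)) (t : Tm L n) (x : Fin n → M) :
    (inst φ t).Realize e x ↔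
      φ.Realize e (Fin.snoc (α := fun _ => M) x (t.realize (Sum.elim e x))) := by
  simp [inst, realize_subst, realize_snoc, v]

theorem Derives.sound {Γ : Set (Fm L n)} {φ : Fm L n} (h : Derives Γ φ) (x : Fin n → M)
    (hx : ∀ ψ ∈ Γ, ψ.Realize e x) : φ.Realize e x := by
  induction h with
  | assumption hφ => exact hx _ hφ
  | impI _ ih => exact fun hφ => ih x (Set.forall_mem_insert.2 ⟨hφ, hx⟩)
  | impE _ _ ih₁ ih₂ => exact ih₁ x hx (ih₂ x hx)
  | raa _ ih =>
    by_contra hφ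
    exact ih x (Set.forall_mem_insert.2 ⟨hφ, hx⟩)
  | allI _ ih =>
    exact fun a => ih _ (Set.forall_mem_image.2 fun ψ hψ => (realize_wk ψ x a).2 (hx ψ hψ))
  | allE t _ ih => exact (realize_inst _ t x).2 (ih x hx _)
  | eqRefl t => rfl
  | eqSubst φ _ _ ih₁ ih₂ =>
    have hst := ih₁ x hx
    have hφ := (realize_inst φ _ x).1 (ih₂ x hx)
    exact (realize_inst φ _ x).2 (hst ▸ hφ)

theorem Provable.sound {T : L.Theory} [M ⊨ T] {σ : L.Sentence} (h : Provable T σ) : M ⊨ σ :=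
  Derives.sound h default fun _ hψ => Theory.realize_sentence_of_mem T hψ

theorem snoc_eq_const {α : Type*} (x : Fin 0 → α) (a : α) :
    Fin.snoc (α := fun _ => α) x a = fun _ => a :=
  eq_const_of_unique (α := Fin 1) _

theorem models_ex_iff (φ : Fm L 1) : M ⊨ φ.ex ↔ ∃ a : M, φ.Realize Empty.elim ![a] := by
  refine BoundedFormula.realize_ex.trans (exists_congr fun a => ?_)
  rw [snoc_eq_const, Matrix.vec_single_eq_const, Subsingleton.elim Empty.elim]

end FOL

namespace ID1

open FirstOrder FirstOrder.Language FOL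

section Semantics

variable {M : Type*} [arith.Structure M] {n m : ℕ}

/-- The expansion of a structure for the language of arithmetic to the language of `ID₁`, with `I`
interpreted as `S`. -/
abbrev expansion (S : Set M) : lang.Structure M where
  funMap := Structure.funMap (L := arith)
  RelMap := fun {k} (R : Rel k) x =>
    match k, R, x with
    | _, .arith f, x => Structure.RelMap (L := arith) f x
    | _, .I, x => x 0 ∈ S

/-- The value of a term of `ID₁` under an assignment of its variables. It does not depend on an
interpretation of `I`, and is therefore defined without fixing one. -/
def value (x : Fin n → M) : Tm lang n → M
  | .var i => Sum.elim default x i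
  | .func f ts => Structure.funMap (L := arith) f fun i => value x (ts i)

/-- Truth of a formula of `ID₁` under an assignment of its free variables, with `I` interpreted as
`S`. -/
def Holds (S : Set M) (φ : Fm lang n) (x : Fin n → M) : Prop :=
  letI := expansion S
  φ.Realize default x

@[simp] theorem value_v (x : Fin n → M) (i : Fin n) : value x (v i) = x i := rfl

@[simp] theorem value_app {k : ℕ} (x : Fin n → M) (f : PR k) (ts : Fin k → Tm lang n) :
    value x (app f ts) = Structure.funMap (L := arith) f fun i => value x (ts i) := rfl

theorem value_snoc (x : Fin m → M) (σ : Fin n → Tm lang m) (t : Tm lang m) :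
    (fun i => value x (Fin.snoc (α := fun _ => Tm lang m) σ t i)) =
      Fin.snoc (fun i => value x (σ i)) (value x t) :=
  Fin.comp_snoc (value x) σ t

theorem value_cons (x : Fin m → M) (t : Tm lang m) (σ : Fin n → Tm lang m) :
    (fun i => value x (Fin.cons (α := fun _ => Tm lang m) t σ i)) =
      Fin.cons (value x t) fun i => value x (σ i) :=
  Fin.comp_cons (value x) t σ

theorem realize_expansion (S : Set M) (t : Tm lang n) (x : Fin n → M) :
    (letI := expansion S; t.realize (Sum.elim default x)) = value x t := by
  induction t with
  | var i => rfl
  | func f ts ih => exact congrArg (Structure.funMap (L := arith) f) (funext ih)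

theorem models_onSentence_incl (S : Set M) (σ : arith.Sentence) :
    letI := expansion S
    M ⊨ incl.onSentence σ ↔ M ⊨ σ :=
  letI := expansion S
  have : incl.IsExpansionOn M := ⟨fun _ _ => rfl, fun _ _ => rfl⟩
  LHom.realize_onSentence M incl σ

variable (S : Set M)

@[simp] theorem holds_equal (s t : Tm lang n) (x : Fin n → M) :
    Holds S (.equal s t) x ↔ value x s = value x t := by
  rw [← realize_expansion S s, ← realize_expansion S t]; rfl

theorem holds_rel_arith {k : ℕ} (f : PR k) (ts : Fin k → Tm lang n) (x : Fin n → M) :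
    Holds S (.rel (L := lang) (Rel.arith f) ts) x ↔
      Structure.RelMap (L := arith) f fun i => value x (ts i) := by
  simp only [← realize_expansion S]; rfl

theorem holds_rel_I (ts : Fin 1 → Tm lang n) (x : Fin n → M) :
    Holds S (.rel (L := lang) Rel.I ts) x ↔ value x (ts 0) ∈ S := by
  rw [← realize_expansion S]; rfl

@[simp] theorem holds_relF {k : ℕ} (f : PR k) (ts : Fin k → Tm lang n) (x : Fin n → M) :
    Holds S (relF f ts) x ↔ Structure.RelMap (L := arith) f fun i => value x (ts i) :=
  holds_rel_arith S f ts x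

@[simp] theorem holds_mem (t : Tm lang n) (x : Fin n → M) :
    Holds S (mem t) x ↔ value x t ∈ S := holds_rel_I S _ x

@[simp] theorem holds_imp (φ ψ : Fm lang n) (x : Fin n → M) :
    Holds S (φ.imp ψ) x ↔ (Holds S φ x → Holds S ψ x) := Iff.rfl

@[simp] theorem holds_all (φ : Fm lang (n + 1)) (x : Fin n → M) :
    Holds S φ.all x ↔ ∀ a, Holds S φ (Fin.snoc x a) := Iff.rfl

@[simp] theorem holds_not (φ : Fm lang n) (x : Fin n → M) :
    Holds S φ.not x ↔ ¬ Holds S φ x := Iff.rfl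

@[simp] theorem holds_inf (φ ψ : Fm lang n) (x : Fin n → M) :
    Holds S (φ ⊓ ψ) x ↔ Holds S φ x ∧ Holds S ψ x :=
  letI := expansion S
  BoundedFormula.realize_inf

@[simp] theorem holds_iff (φ ψ : Fm lang n) (x : Fin n → M) :
    Holds S (φ.iff ψ) x ↔ (Holds S φ x ↔ Holds S ψ x) :=
  letI := expansion S
  BoundedFormula.realize_iff

theorem holds_alls (φ : Fm lang n) (x : Fin 0 → M) :
    Holds S φ.alls x ↔ ∀ y, Holds S φ y :=
  letI := expansion S
  Subsingleton.elim x default ▸ BoundedFormula.realize_alls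

theorem holds_subst (φ : Fm lang n) (σ : Fin n → Tm lang m) (x : Fin m → M) :
    Holds S (subst φ σ) x ↔ Holds S φ fun i => value x (σ i) := by
  simp only [← realize_expansion S]
  let := expansion S
  exact realize_subst φ σ x

theorem holds_inst (φ : Fm lang (n + 1)) (t : Tm lang n) (x : Fin n → M) :
    Holds S (inst φ t) x ↔ Holds S φ (Fin.snoc x (value x t)) := by
  simp only [inst, holds_subst, value_snoc, value_v]

theorem holds_replaceI (φ : Fm lang (n + 1)) {k : ℕ} (ρ : Fin n → Fin k) (χ : Fm lang k)
    (x : Fin k → M) :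
    Holds S (replaceI φ ρ χ) x ↔ Holds {a | Holds S φ (Fin.snoc (x ∘ ρ) a)} χ x := by
  induction χ with
  | falsum => rfl
  | equal s t => simp only [replaceI, holds_equal]
  | rel R ts =>
    cases R with
    | arith f => simp only [replaceI, holds_relF, holds_rel_arith]
    | I =>
      simp only [replaceI, holds_subst, value_snoc, value_v, holds_rel_I]
      rfl
  | imp χ ψ ihχ ihψ => simp only [replaceI, holds_imp, ihχ, ihψ]
  | all χ ih => simp [replaceI, ih, Function.comp_def]

theorem holds_plug (A : Fm lang 1) (φ : Fm lang (n + 1)) (x : Fin n → M) (a : M) :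
    Holds S (plug A φ) (Fin.snoc x a) ↔ Holds {b | Holds S φ (Fin.snoc x b)} A fun _ => a := by
  simp [plug, holds_replaceI, holds_subst, Function.comp_def]

end Semantics

section InductiveDefinition

variable {M : Type*} [arith.Structure M] {n : ℕ}

theorem monotone_and_antitone_holds (φ : Fm lang n) (x : Fin n → M) :
    (Occurs true φ → Monotone fun S : Set M => Holds S φ x) ∧
      (Occurs false φ → Antitone fun S : Set M => Holds S φ x) := by
  induction φ with
  | falsum => exact ⟨fun _ _ _ _ => id, fun _ _ _ _ => id⟩
  | equal s t =>
    simp only [holds_equal]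
    exact ⟨fun _ => monotone_const, fun _ => antitone_const⟩
  | rel R ts =>
    cases R with
    | arith f =>
      simp only [holds_rel_arith]
      exact ⟨fun _ => monotone_const, fun _ => antitone_const⟩
    | I =>
      simp only [holds_rel_I]
      exact ⟨fun _ _ _ hST h => hST h, nofun⟩
  | imp φ ψ ihφ ihψ =>
    exact ⟨fun h _ _ hST hS hφ => (ihψ x).1 h.2 hST (hS ((ihφ x).2 h.1 hST hφ)),
      fun h _ _ hST hT hφ => (ihψ x).2 h.2 hST (hT ((ihφ x).1 h.1 hST hφ))⟩
  | all φ ih =>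
    exact ⟨fun h _ _ hST hS a => (ih _).1 h hST (hS a),
      fun h _ _ hST hT a => (ih _).2 h hST (hT a)⟩

variable {A : Fm lang 1} (hA : Occurs true A)

variable (M) in
/-- The monotone operator `S ↦ {a | A(a, S)}` defined by an operator form `A`, in which the second
order variable is written as `I`. -/
def operator : Set M →o Set M where
  toFun S := {a | Holds S A fun _ => a}
  monotone' _ _ hST _ := (monotone_and_antitone_holds A _).1 hA hST

variable (M) in
/-- The set inductively defined by an operator form. -/
def inductiveSet : Set M := (operator M hA).lfp

theorem holds_inductiveDefinition (x : Fin 0 → M) :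
    Holds (inductiveSet M hA) ((mem (v 0)).iff A).all x := by
  simp only [holds_all, holds_iff, holds_mem, value_v, snoc_eq_const]
  exact fun a => iff_of_eq (congrArg (a ∈ ·) (operator M hA).map_lfp.symm)

theorem holds_inductiveClosure (φ : Fm lang (n + 1)) (x : Fin 0 → M) :
    Holds (inductiveSet M hA)
      (((plug A φ).imp φ).all.imp ((mem (v (Fin.last n))).imp φ).all).alls x := by
  simp only [holds_alls, holds_imp, holds_all, holds_mem, holds_plug, value_v, Fin.snoc_last]
  intro _ hclosed
  exact (operator M hA).lfp_le hclosed

end InductiveDefinition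

section StandardModel

variable {n : ℕ} (S : Set ℕ)

@[simp] theorem value_zeroT (x : Fin n → ℕ) : value x zeroT = 0 := rfl

@[simp] theorem value_succT (x : Fin n → ℕ) (t : Tm lang n) : value x (succT t) = value x t + 1 :=
  rfl

@[simp] theorem funMap_eq_eval (f : PR n) (x : Fin n → ℕ) :
    Structure.funMap (L := arith) f x = f.eval x := rfl

@[simp] theorem relMap_iff_eval_eq_zero (f : PR n) (x : Fin n → ℕ) :
    Structure.RelMap (L := arith) f x ↔ f.eval x = 0 := Iff.rfl

theorem holds_induction (φ : Fm lang (n + 1)) (x : Fin 0 → ℕ) :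
    Holds S ((inst φ zeroT ⊓
      (φ.imp (subst φ (Fin.snoc (α := fun _ => Tm lang (n + 1)) (fun i => v i.castSucc)
        (succT (v (Fin.last n)))))).all).imp φ.all).alls x := by
  simp only [holds_alls, holds_imp, holds_inf, holds_inst, holds_all, holds_subst, value_snoc,
    value_zeroT, value_succT, value_v, Fin.snoc_last, Fin.snoc_castSucc]
  rintro _ ⟨hzero, hsucc⟩ a
  induction a with
  | zero => exact hzero
  | succ a ih => exact hsucc a ih

theorem IsAxiom.holds {A : Fm lang 1} (hA : Occurs true A) {σ : lang.Sentence}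
    (h : IsAxiom A σ) (x : Fin 0 → ℕ) : Holds (inductiveSet ℕ hA) σ x := by
  cases h with
  | succ_ne_zero => simp [holds_alls]
  | succ_inj => simp [holds_alls]
  | proj i => simp [holds_alls, PR.eval]
  | comp f g => simp [holds_alls, PR.eval]
  | prec_zero f g =>
    simp only [holds_alls, holds_equal, value_app, value_cons]
    exact fun _ => rfl
  | prec_succ f g =>
    simp only [holds_alls, holds_equal, value_app, value_cons]
    exact fun _ => rfl
  | pred f => simp [holds_alls]
  | induction φ => exact holds_induction _ φ x
  | inductiveDefinition => exact holds_inductiveDefinition (M := ℕ) hA x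
  | inductiveClosure φ => exact holds_inductiveClosure (M := ℕ) hA φ x

end StandardModel

end ID1

theorem mainTheorem1_general (A : FOL.Fm ID1.lang 1) (hA : ID1.Occurs true A)
    (σ : ID1.arith.Sentence) (hprov : FOL.Provable (ID1.theory A) (ID1.incl.onSentence σ)) :
    ℕ ⊨ σ := by
  let := ID1.expansion (ID1.inductiveSet ℕ hA)
  have : ℕ ⊨ ID1.theory A := (FirstOrder.Language.Theory.model_iff _).2 fun _ hψ => hψ.holds hA _
  exact (ID1.models_onSentence_incl _ σ).1 hprov.sound

theorem mainTheorem1 (A : FOL.Fm ID1.lang 1) (hA : ID1.Occurs true A)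
    (φ : FOL.Fm ID1.arith 1) (hφ : φ.IsQF)
    (hprov : FOL.Provable (ID1.theory A) (ID1.incl.onBoundedFormula φ).ex) :
    ∃ n : ℕ, φ.Realize Empty.elim ![n] :=
  (FOL.models_ex_iff φ).1 (mainTheorem1_general A hA φ.ex hprov)
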